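/- All graphs are simple. For a connected, locally finite graph with vertex set $V$ let $\Delta f(x)=\sum_{y\sim x}\big(f(x)-f(y)\big)$. For finite $W\subset V$ let $\Delta_W$ be the Laplacian on $W$ with Dirichlet boundary conditions (extend a function on $W$ by zero, apply $\Delta$, restrict to $W$), let $p^W_t(x,y)$ be the entries of the matrix $e^{-t\Delta_W}$, set to $0$ unless $x,y\in W$, and let $p_t(x,y)=\sup_W p_t^W(x,y)$ be the (minimal) heat kernel. The graph is called stochastically incomplete if $\sum_{y\in V}p_t(x,y)<1$ for some $t>0$ and some $x\in V$. Let $k:\{0,1,2,\dots\}\to\{1,2,3,\dots\}$ and $\tilde k:\{0,1,2,\dots\}\to\{0,1,2,\dots\}$. Let $T_k$ be the spherically symmetric tree with branching numbers $k(r)$, that is, the tree with a root $x_0$ such that, for every $r\ge 0$, each vertex of the sphere $S_r=\{x : d(x,x_0)=r\}$ has exactly $k(r)$ neighbors in $S_{r+1}$. Let $T_k^{\tilde k}$ be the graph obtained from $T_k$ by attaching, for every $r\ge0$, $\tilde k(r)$ new end vertices (vertices of degree $1$) to each vertex of $S_r$. Then $T_k^{\tilde k}$ is stochastically incomplete if and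 only if $$\sum_{r=0}^\infty \frac{\tilde k(r)+1}{k(r)}<\infty .$$ -/

import Mathlib

open Finset
open scoped ENNReal

namespace GraphHeat

section Laplacian

variable {V : Type*} (G : SimpleGraph V) [G.LocallyFinite]

/-- The (positive) graph Laplacian `Δ f (x) = ∑_{y ∼ x} (f x - f y)`
of a locally finite graph. -/
def laplacian (f : V → ℝ) (x : V) : ℝ :=
  ∑ y ∈ G.neighborFinset x, (f x - f y)

open Classical in
/-- The Laplacian with Dirichlet boundary conditions on a finite set `W` of vertices: functions
on `W` are extended by zero to all vertices, `Δ` is applied and the result is restricted to `W`.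
It is written here as a matrix, so that its diagonal holds the degrees taken in the whole graph
and its `(x, y)` entry is `-1` for adjacent `x, y ∈ W`. -/
noncomputable def dirichletLaplacian (W : Finset V) : Matrix W W ℝ :=
  Matrix.of fun x y => laplacian G (Pi.single (y : V) 1) x

open Classical in
/-- The heat kernel of a finite set `W` of vertices with Dirichlet boundary conditions:
the entries of `exp (-t Δ_W)`, extended by zero outside of `W × W`. -/
noncomputable def dirichletHeatKernel (W : Finset V) (t : ℝ) (x y : V) : ℝ :=
  if h : x ∈ W ∧ y ∈ W then
    (NormedSpace.exp ((-t) • dirichletLaplacian G W) : Matrix W W ℝ) ⟨x, h.1⟩ ⟨y, h.2⟩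
  else 0

/-- The (minimal) heat kernel `p_t(x, y)` of the graph, obtained by exhausting the vertex set by
finite sets. The Dirichlet heat kernels are non-negative and increase with `W`, so that the limit
along any exhaustion is the supremum over all finite sets of vertices. -/
noncomputable def heatKernel (t : ℝ) (x y : V) : ℝ≥0∞ :=
  ⨆ W : Finset V, ENNReal.ofReal (dirichletHeatKernel G W t x y)

/-- Stochastic incompleteness: `∑_y p_t(x, y) < 1` for some time `t > 0` and some vertex `x`. -/
def StochasticallyIncomplete : Prop :=
  ∃ t : ℝ, 0 < t ∧ ∃ x : V, ∑' y : V, heatKernel G t x y < 1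

end Laplacian

section Trees

variable {V : Type*}

/-- `T` is a spherically symmetric tree with root `x₀` and branching numbers `k`: it is a tree in
which every vertex of the sphere `S_r` about `x₀` has exactly `k r` neighbours in `S_{r+1}`. -/
structure IsSphericallySymmetricTree (T : SimpleGraph V) [T.LocallyFinite] (x₀ : V)
    (k : ℕ → ℕ) : Prop where
  isTree : T.IsTree
  card_outer : ∀ x : V,
    #{y ∈ T.neighborFinset x | T.dist x₀ y = T.dist x₀ x + 1} = k (T.dist x₀ x)

/-- The graph obtained from `G` by attaching `n x` end vertices to every vertex `x`. The vertices
are those of `G` together with new ones `⟨x, i⟩`, `i < n x`; the edges are those of `G`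
together with the edges from `x` to `⟨x, i⟩`. -/
def attachEnds (G : SimpleGraph V) (n : V → ℕ) : SimpleGraph (V ⊕ (Σ x : V, Fin (n x))) where
  Adj a b := match a, b with
    | Sum.inl x, Sum.inl y => G.Adj x y
    | Sum.inl x, Sum.inr e => e.1 = x
    | Sum.inr e, Sum.inl x => e.1 = x
    | Sum.inr _, Sum.inr _ => False
  symm := ⟨by
    rintro (x | e) (y | f) h
    · exact G.adj_symm h
    · exact h
    · exact h
    · exact h⟩
  loopless := ⟨by
    rintro (x | e) h
    · exact G.irrefl h
    · exact h⟩

theorem attachEnds_neighborSet_finite (G : SimpleGraph V) [G.LocallyFinite] (n : V → ℕ)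
    (a : V ⊕ (Σ x : V, Fin (n x))) : ((attachEnds G n).neighborSet a).Finite := by
  rcases a with x | e
  · refine (((G.neighborSet x).toFinite.image Sum.inl).union
      (Set.finite_range fun i : Fin (n x) => Sum.inr ⟨x, i⟩)).subset ?_
    rintro (y | ⟨z, i⟩) h
    · exact Or.inl ⟨y, h, rfl⟩
    · obtain rfl : z = x := h
      exact Or.inr ⟨i, rfl⟩
  · refine (Set.finite_singleton (Sum.inl e.1)).subset ?_
    rintro (y | f) h
    · obtain rfl : e.1 = y := h
      rfl
    · exact (h : False).elim

noncomputable instance attachEnds_locallyFinite (G : SimpleGraph V) [G.LocallyFinite]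
    (n : V → ℕ) : (attachEnds G n).LocallyFinite :=
  fun a => (attachEnds_neighborSet_finite G n a).fintype

end Trees

end GraphHeat

/-!
Comparison with supersolutions of the heat equation reduces both implications to test functions.
A function `v` which is bounded above and somewhere positive, with `Δ v ≤ -c v` for some `c > 0`,
bounds `∑ y, p_t(x, y)` by a number less than `1` for large `t`; a function `v ≥ 0` tending to
infinity with `-c v ≤ Δ v` forces the sum to be `1` (Khas'minskii). We take `v` radial on the
original graph, `v = f (r)` with `f (r + 1) = (1 + a r) f (r)`, and `f (r) / 2` at the ends attached
to the sphere of radius `r`, where then `Δ v = -v`. On the sphere itself the condition on `v` says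
that `k (r) * a r` is bounded below, respectively above, by a multiple of `k' (r) + 1`, and `f` is
bounded exactly when `a` is summable.
-/

namespace GraphHeat

open Filter Topology

/-! ### Exponentials of matrices with nonpositive off-diagonal entries -/

section Matrix

open Matrix
open scoped Matrix.Norms.Operator

variable {ι : Type*} [Fintype ι]

theorem hasDerivAt_mulVec {M : ℝ → Matrix ι ι ℝ} {M' : Matrix ι ι ℝ} {v : ℝ → ι → ℝ}
    {v' : ι → ℝ} {s : ℝ} (hM : HasDerivAt M M' s) (hv : HasDerivAt v v' s) :
    HasDerivAt (fun u => M u *ᵥ v u) (M' *ᵥ v s + M s *ᵥ v') s := by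
  refine hasDerivAt_pi.2 fun i => ?_
  have hentry : ∀ j, HasDerivAt (fun u => M u i j) (M' i j) s := fun j =>
    hasDerivAt_pi.1 (hasDerivAt_pi.1 hM i) j
  simpa only [mulVec, dotProduct, Pi.add_apply, sum_add_distrib] using
    HasDerivAt.fun_sum fun j (_ : j ∈ univ) => (hentry j).fun_mul (hasDerivAt_pi.1 hv j)

variable [DecidableEq ι] {A : Matrix ι ι ℝ} {t : ℝ}

theorem matrix_exp_apply_nonneg (hA : ∀ i j, 0 ≤ A i j) (i j : ι) :
    0 ≤ NormedSpace.exp A i j := by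
  have hsum : HasSum (fun m : ℕ => ((m.factorial : ℝ)⁻¹ • A ^ m) i j) (NormedSpace.exp A i j) :=
    Pi.hasSum.1 (Pi.hasSum.1 (NormedSpace.exp_series_hasSum_exp' (𝕂 := ℝ) A) i) j
  exact hsum.nonneg fun m => mul_nonneg (by positivity) (pow_apply_nonneg hA m i j)

theorem matrix_exp_smul_one_add (c : ℝ) (B : Matrix ι ι ℝ) :
    NormedSpace.exp (c • (1 : Matrix ι ι ℝ) + B) = Real.exp c • NormedSpace.exp B := by
  have hscalar : NormedSpace.exp (c • (1 : Matrix ι ι ℝ)) =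
      Real.exp c • (1 : Matrix ι ι ℝ) := by
    rw [← Algebra.algebraMap_eq_smul_one, ← Algebra.algebraMap_eq_smul_one, Real.exp_eq_exp_ℝ]
    exact (NormedSpace.algebraMap_exp_comm c).symm
  rw [Matrix.exp_add_of_commute _ _ ((Commute.one_left B).smul_left c), hscalar, smul_one_mul]

theorem matrix_exp_neg_smul_apply_nonneg (hA : ∀ i j, i ≠ j → A i j ≤ 0) (ht : 0 ≤ t) (i j : ι) :
    0 ≤ NormedSpace.exp ((-t) • A) i j := by
  -- `d` exceeds the diagonal entries, so that `d • 1 - A` has nonnegative entries.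
  set d : ℝ := ∑ i, |A i i|
  have hd : ∀ i, A i i ≤ d := fun i => (le_abs_self _).trans
    (single_le_sum (f := fun i => |A i i|) (fun _ _ => abs_nonneg _) (mem_univ i))
  have hshift : (-t) • A = (-(t * d)) • (1 : Matrix ι ι ℝ) + t • (d • (1 : Matrix ι ι ℝ) - A) := by
    module
  rw [hshift, matrix_exp_smul_one_add]
  refine mul_nonneg (Real.exp_pos _).le (matrix_exp_apply_nonneg (fun a b => ?_) i j)
  refine mul_nonneg ht ?_
  obtain rfl | hab := eq_or_ne a b
  · simpa using hd a
  · simpa [one_apply_ne hab] using hA a b hab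

theorem matrix_exp_neg_smul_mulVec_le (hA : ∀ i j, i ≠ j → A i j ≤ 0) (ht : 0 ≤ t)
    {φ φ' : ℝ → ι → ℝ} (hφ : ∀ s ∈ Set.Icc 0 t, HasDerivAt φ (φ' s) s)
    (hsuper : ∀ s ∈ Set.Icc 0 t, 0 ≤ φ' s + A *ᵥ φ s) :
    NormedSpace.exp ((-t) • A) *ᵥ φ 0 ≤ φ t := by
  set E : ℝ → Matrix ι ι ℝ := fun s => NormedSpace.exp ((s - t) • A) with hE
  have hderiv : ∀ s ∈ Set.Icc 0 t,
      HasDerivAt (fun u => E u *ᵥ φ u) (E s *ᵥ (φ' s + A *ᵥ φ s)) s := by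
    intro s hs
    have hEs : HasDerivAt E (E s * A) s := by
      have h := (hasDerivAt_exp_smul_const (𝕂 := ℝ) A (s - t)).scomp s
        ((hasDerivAt_id s).sub_const t)
      rw [one_smul] at h
      exact h
    simpa only [mulVec_add, mulVec_mulVec, add_comm] using hasDerivAt_mulVec hEs (hφ s hs)
  have hEnonneg : ∀ s ∈ Set.Icc 0 t, ∀ i j, 0 ≤ E s i j := fun s hs i j => by
    simpa only [neg_sub] using matrix_exp_neg_smul_apply_nonneg hA (sub_nonneg.2 hs.2) i j
  intro i
  have hmono : MonotoneOn (fun u => (E u *ᵥ φ u) i) (Set.Icc 0 t) :=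
    monotoneOn_of_hasDerivWithinAt_nonneg (convex_Icc 0 t)
      (fun s hs => (hasDerivAt_pi.1 (hderiv s hs) i).continuousAt.continuousWithinAt)
      (fun s hs => (hasDerivAt_pi.1 (hderiv s (interior_subset hs)) i).hasDerivWithinAt)
      fun s hs => sum_nonneg fun j _ => mul_nonneg (hEnonneg s (interior_subset hs) i j)
        (hsuper s (interior_subset hs) j)
  simpa [hE] using hmono (Set.left_mem_Icc.2 ht) (Set.right_mem_Icc.2 ht) ht

end Matrix

/-! ### The Dirichlet heat kernels -/

section HeatKernel

variable {V : Type*} (G : SimpleGraph V) [G.LocallyFinite] {W : Finset V} {t : ℝ} {x y : V}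

theorem laplacian_const_sub_const_mul (a b : ℝ) (v : V → ℝ) (x : V) :
    laplacian G (fun z => a - b * v z) x = -(b * laplacian G v x) := by
  simp only [laplacian, mul_sum, ← sum_neg_distrib]
  exact sum_congr rfl fun y _ => by ring

theorem dirichletLaplacian_apply_nonpos {i j : W} (hij : i ≠ j) :
    dirichletLaplacian G W i j ≤ 0 := by
  classical
  have hval : (i : V) ≠ j := Subtype.coe_ne_coe.2 hij
  simp only [dirichletLaplacian, Matrix.of_apply, laplacian, Pi.single_eq_of_ne hval, zero_sub]
  have hpos : (0 : V → ℝ) ≤ Pi.single (j : V) 1 := Pi.single_nonneg.2 zero_le_one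
  exact sum_nonpos fun y _ => neg_nonpos.2 (hpos y)

open Classical in
theorem dirichletLaplacian_mulVec (W : Finset V) (u : V → ℝ) (x : W) :
    (dirichletLaplacian G W).mulVec (fun z : W => u z) x =
      laplacian G (fun y => if y ∈ W then u y else 0) x := by
  have hextend : ∀ z : V, ∑ j : W, (Pi.single (j : V) (1 : ℝ) : V → ℝ) z * u j =
      if z ∈ W then u z else 0 := fun z => by
    rw [univ_eq_attach, sum_attach W fun j => (Pi.single j (1 : ℝ) : V → ℝ) z * u j]
    simp [Pi.single_apply]
  simp only [Matrix.mulVec, dotProduct, dirichletLaplacian, Matrix.of_apply, laplacian, sum_mul]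
  rw [sum_comm]
  exact sum_congr rfl fun y _ => by simp only [sub_mul, sum_sub_distrib, hextend]

open Classical in
theorem dirichletHeatKernel_of_mem (t : ℝ) (hx : x ∈ W) (hy : y ∈ W) :
    dirichletHeatKernel G W t x y =
      (NormedSpace.exp ((-t) • dirichletLaplacian G W) : Matrix W W ℝ) ⟨x, hx⟩ ⟨y, hy⟩ :=
  dif_pos ⟨hx, hy⟩

theorem dirichletHeatKernel_of_notMem_left (t : ℝ) (hx : x ∉ W) (y : V) :
    dirichletHeatKernel G W t x y = 0 :=
  dif_neg fun h => hx h.1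

theorem dirichletHeatKernel_of_notMem_right (t : ℝ) (x : V) (hy : y ∉ W) :
    dirichletHeatKernel G W t x y = 0 :=
  dif_neg fun h => hy h.2

theorem dirichletHeatKernel_nonneg (W : Finset V) (ht : 0 ≤ t) (x y : V) :
    0 ≤ dirichletHeatKernel G W t x y := by
  classical
  unfold dirichletHeatKernel
  split_ifs
  · exact matrix_exp_neg_smul_apply_nonneg (fun _ _ => dirichletLaplacian_apply_nonpos G) ht _ _
  · exact le_rfl

open Classical in
theorem dirichletHeatKernel_zero (hx : x ∈ W) (y : V) :
    dirichletHeatKernel G W 0 x y = if x = y then 1 else 0 := by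
  by_cases hy : y ∈ W
  · rw [dirichletHeatKernel_of_mem G 0 hx hy, neg_zero, zero_smul, NormedSpace.exp_zero,
      Matrix.one_apply]
    simp only [Subtype.mk.injEq]
  · rw [dirichletHeatKernel_of_notMem_right G 0 x hy, if_neg (ne_of_mem_of_not_mem hx hy)]

open Classical in
theorem sum_dirichletHeatKernel_mul (t : ℝ) (u : V → ℝ) (hx : x ∈ W) :
    ∑ y ∈ W, dirichletHeatKernel G W t x y * u y =
      (NormedSpace.exp ((-t) • dirichletLaplacian G W) : Matrix W W ℝ).mulVec
        (fun z : W => u z) ⟨x, hx⟩ := by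
  rw [← sum_attach W, ← univ_eq_attach]
  exact sum_congr rfl fun y _ => by rw [dirichletHeatKernel_of_mem G t hx y.2]

open scoped Matrix.Norms.Operator in
theorem hasDerivAt_dirichletHeatKernel (hx : x ∈ W) (hy : y ∈ W) (s : ℝ) :
    HasDerivAt (fun u => dirichletHeatKernel G W u x y)
      (-laplacian G (fun z => dirichletHeatKernel G W s z y) x) s := by
  classical
  set L := dirichletLaplacian G W
  have hexp : HasDerivAt (fun u : ℝ => NormedSpace.exp ((-u) • L))
      (-(L * NormedSpace.exp ((-s) • L))) s := by
    have h := (hasDerivAt_exp_smul_const' (𝕂 := ℝ) L (-s)).scomp s (hasDerivAt_neg s)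
    rw [neg_one_smul] at h
    exact h
  have hextend : (fun z => if z ∈ W then dirichletHeatKernel G W s z y else 0) =
      fun z => dirichletHeatKernel G W s z y :=
    funext fun z => ite_eq_left_iff.2 fun hz => (dirichletHeatKernel_of_notMem_left G s hz y).symm
  have hlap : (L * NormedSpace.exp ((-s) • L)) ⟨x, hx⟩ ⟨y, hy⟩ =
      laplacian G (fun z => dirichletHeatKernel G W s z y) x := by
    rw [← hextend, ← dirichletLaplacian_mulVec G W _ ⟨x, hx⟩, Matrix.mul_apply]
    simp only [Matrix.mulVec, dotProduct]
    exact sum_congr rfl fun z _ => by rw [dirichletHeatKernel_of_mem G s z.2 hy]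
  simp only [dirichletHeatKernel_of_mem G _ hx hy, ← hlap]
  exact hasDerivAt_pi.1 (hasDerivAt_pi.1 hexp ⟨x, hx⟩) ⟨y, hy⟩

theorem sum_dirichletHeatKernel_mul_le (ht : 0 ≤ t) {φ φ' : ℝ → V → ℝ}
    (hφ : ∀ s ∈ Set.Icc 0 t, ∀ z ∈ W, HasDerivAt (fun u => φ u z) (φ' s z) s)
    (hout : ∀ s ∈ Set.Icc 0 t, ∀ z ∉ W, 0 ≤ φ s z)
    (hsuper : ∀ s ∈ Set.Icc 0 t, ∀ z ∈ W, 0 ≤ φ' s z + laplacian G (φ s) z) (hx : x ∈ W) :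
    ∑ y ∈ W, dirichletHeatKernel G W t x y * φ 0 y ≤ φ t x := by
  classical
  -- Extending by zero instead of by `φ s ≥ 0` outside of `W` increases the Laplacian on `W`.
  have hlap : ∀ s ∈ Set.Icc 0 t, ∀ z ∈ W,
      laplacian G (φ s) z ≤ laplacian G (fun y => if y ∈ W then φ s y else 0) z := by
    intro s hs z hz
    refine sum_le_sum fun y _ => ?_
    simp only [if_pos hz]
    split_ifs with hy
    · exact le_rfl
    · exact sub_le_sub_left (hout s hs y hy) _
  rw [sum_dirichletHeatKernel_mul G t (φ 0) hx]
  refine matrix_exp_neg_smul_mulVec_le (fun _ _ => dirichletLaplacian_apply_nonpos G) ht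
    (φ := fun s (z : W) => φ s z) (φ' := fun s (z : W) => φ' s z)
    (fun s hs => hasDerivAt_pi.2 fun z => hφ s hs z z.2) (fun s hs z => ?_) ⟨x, hx⟩
  rw [Pi.add_apply, dirichletLaplacian_mulVec]
  exact (hsuper s hs z z.2).trans (add_le_add_right (hlap s hs z z.2) _)

theorem dirichletHeatKernel_mono (ht : 0 ≤ t) (x y : V) :
    Monotone fun W : Finset V => dirichletHeatKernel G W t x y := by
  classical
  intro W W' hW
  simp only
  by_cases hx : x ∈ W
  swap
  · rw [dirichletHeatKernel_of_notMem_left G t hx]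
    exact dirichletHeatKernel_nonneg G W' ht x y
  by_cases hy : y ∈ W
  swap
  · rw [dirichletHeatKernel_of_notMem_right G t x hy]
    exact dirichletHeatKernel_nonneg G W' ht x y
  calc dirichletHeatKernel G W t x y
      = ∑ z ∈ W, dirichletHeatKernel G W t x z * if z = y then 1 else 0 := by simp [hy]
    _ = ∑ z ∈ W, dirichletHeatKernel G W t x z * dirichletHeatKernel G W' 0 z y :=
        sum_congr rfl fun z hz => by rw [dirichletHeatKernel_zero G (hW hz)]
    _ ≤ dirichletHeatKernel G W' t x y :=
        sum_dirichletHeatKernel_mul_le G ht (φ := fun s z => dirichletHeatKernel G W' s z y)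
          (fun s _ z hz => hasDerivAt_dirichletHeatKernel G (hW hz) (hW hy) s)
          (fun s hs z _ => dirichletHeatKernel_nonneg G W' hs.1 z y)
          (fun s _ z _ => (neg_add_cancel _).ge) hx

theorem tsum_heatKernel_eq_iSup (ht : 0 ≤ t) (x : V) :
    ∑' y, heatKernel G t x y =
      ⨆ W : Finset V, ENNReal.ofReal (∑ y ∈ W, dirichletHeatKernel G W t x y) := by
  classical
  have hmono : ∀ y, Monotone fun W => ENNReal.ofReal (dirichletHeatKernel G W t x y) :=
    fun y => ENNReal.ofReal_mono.comp (dirichletHeatKernel_mono G ht x y)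
  simp only [ENNReal.ofReal_sum_of_nonneg fun y _ => dirichletHeatKernel_nonneg G _ ht x y]
  refine le_antisymm ?_ (iSup_le fun W => ?_)
  · simp only [ENNReal.tsum_eq_iSup_sum, heatKernel, ENNReal.finsetSum_iSup_of_monotone hmono]
    refine iSup₂_le fun F W => le_iSup_of_le (W ∪ F) ?_
    exact (sum_le_sum fun y _ => hmono y subset_union_left).trans
      (sum_le_sum_of_subset subset_union_right)
  · exact (sum_le_sum fun y _ =>
      le_iSup (fun W => ENNReal.ofReal (dirichletHeatKernel G W t x y)) W).trans
        (ENNReal.sum_le_tsum W)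

/-! ### Khas'minskii-type criteria -/

variable {v : V → ℝ} {c : ℝ}

theorem sum_dirichletHeatKernel_mul_sub_le (ht : 0 ≤ t) {a : ℝ}
    (hout : ∀ s ∈ Set.Icc 0 t, ∀ z ∉ W, Real.exp (c * s) * v z ≤ a)
    (hv : ∀ z ∈ W, laplacian G v z ≤ -(c * v z)) (hx : x ∈ W) :
    ∑ y ∈ W, dirichletHeatKernel G W t x y * (a - v y) ≤ a - Real.exp (c * t) * v x := by
  have hcomp := sum_dirichletHeatKernel_mul_le G ht
    (φ := fun s z => a - Real.exp (c * s) * v z)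
    (φ' := fun s z => -(Real.exp (c * s) * c * v z)) (W := W)
    (fun s _ z _ => ?_) (fun s hs z hz => sub_nonneg.2 (hout s hs z hz)) (fun s _ z hz => ?_) hx
  · simpa using hcomp
  · simpa using (((((hasDerivAt_id s).const_mul c).exp).mul_const (v z)).const_sub a)
  · rw [laplacian_const_sub_const_mul]
    linarith [mul_le_mul_of_nonneg_left (hv z hz) (Real.exp_pos (c * s)).le]

theorem sum_dirichletHeatKernel_le {M : ℝ} (hc : 0 ≤ c) (hM0 : 0 ≤ M) (hM : ∀ z, v z ≤ M)
    (hv : ∀ z, laplacian G v z ≤ -(c * v z)) (ht : 0 ≤ t) (hx : x ∈ W) :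
    (1 - Real.exp (-(c * t))) * M * ∑ y ∈ W, dirichletHeatKernel G W t x y ≤ M - v x := by
  set q := Real.exp (-(c * t)) with hq
  have hlap : ∀ z, laplacian G (fun z => q * v z) z ≤ -(c * (q * v z)) := fun z => by
    have hscale : laplacian G (fun z => q * v z) z = q * laplacian G v z := by
      simp only [laplacian, mul_sum, mul_sub]
    rw [hscale]
    linarith [mul_le_mul_of_nonneg_left (hv z) (Real.exp_pos (-(c * t))).le]
  have hout : ∀ s ∈ Set.Icc 0 t, ∀ z ∉ W, Real.exp (c * s) * (q * v z) ≤ M := by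
    intro s hs z _
    have hle : Real.exp (c * s) * q ≤ 1 := by
      rw [hq, ← Real.exp_add, Real.exp_le_one_iff]
      linarith [mul_le_mul_of_nonneg_left hs.2 hc]
    calc Real.exp (c * s) * (q * v z) ≤ Real.exp (c * s) * (q * M) := by gcongr; exact hM z
      _ = Real.exp (c * s) * q * M := by ring
      _ ≤ M := mul_le_of_le_one_left hM0 hle
  calc (1 - q) * M * ∑ y ∈ W, dirichletHeatKernel G W t x y
      = ∑ y ∈ W, dirichletHeatKernel G W t x y * (M - q * M) := by rw [← sum_mul]; ring
    _ ≤ ∑ y ∈ W, dirichletHeatKernel G W t x y * (M - q * v y) := by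
        gcongr with y
        · exact dirichletHeatKernel_nonneg G W ht x y
        · exact hM y
    _ ≤ M - Real.exp (c * t) * (q * v x) :=
        sum_dirichletHeatKernel_mul_sub_le G ht hout (fun z _ => hlap z) hx
    _ = M - v x := by rw [hq, ← mul_assoc, ← Real.exp_add, add_neg_cancel, Real.exp_zero, one_mul]

theorem one_sub_le_sum_dirichletHeatKernel {C : ℝ} (hc : 0 ≤ c) (hC : 0 < C)
    (hv0 : ∀ z, 0 ≤ v z) (hout : ∀ z ∉ W, C ≤ v z) (hv : ∀ z ∈ W, -(c * v z) ≤ laplacian G v z)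
    (ht : 0 ≤ t) (hx : x ∈ W) :
    1 - Real.exp (c * t) * v x / C ≤ ∑ y ∈ W, dirichletHeatKernel G W t x y := by
  have hcomp := sum_dirichletHeatKernel_mul_sub_le G (v := fun z => -(v z / C)) (a := -1) (c := c)
    ht (fun s hs z hz => ?_) (fun z hz => ?_) hx
  · have hlower : -∑ y ∈ W, dirichletHeatKernel G W t x y ≤
        ∑ y ∈ W, dirichletHeatKernel G W t x y * (-1 - -(v y / C)) := by
      rw [← sum_neg_distrib]
      refine sum_le_sum fun y _ => ?_
      have := mul_nonneg (dirichletHeatKernel_nonneg G W ht x y) (div_nonneg (hv0 y) hC.le)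
      linarith
    rw [mul_div_assoc]
    linarith
  · have hexp : 1 ≤ Real.exp (c * s) := Real.one_le_exp (mul_nonneg hc hs.1)
    have hquot : 1 ≤ v z / C := (one_le_div hC).2 (hout z hz)
    linarith [one_le_mul_of_one_le_of_one_le hexp hquot]
  · have hscale : laplacian G (fun z => -(v z / C)) z = -(laplacian G v z / C) := by
      simp only [laplacian, sum_div, ← sum_neg_distrib]
      exact sum_congr rfl fun y _ => by ring
    rw [hscale]
    have := div_le_div_of_nonneg_right (hv z hz) hC.le
    linarith [mul_div_assoc c (v z) C, neg_div C (c * v z)]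

theorem stochasticallyIncomplete_of_laplacian_le {M : ℝ} (hc : 0 < c) (hM : ∀ z, v z ≤ M)
    (hv : ∀ z, laplacian G v z ≤ -(c * v z)) (hx : 0 < v x) : StochasticallyIncomplete G := by
  have hM0 : 0 < M := hx.trans_le (hM x)
  obtain ⟨t, ht, hvx⟩ : ∃ t : ℝ, 0 < t ∧ Real.exp (-(c * t)) * M < v x := by
    have hlim : Tendsto (fun t : ℝ => Real.exp (-(c * t)) * M) atTop (𝓝 (0 * M)) :=
      (Real.tendsto_exp_neg_atTop_nhds_zero.comp (tendsto_id.const_mul_atTop hc)).mul_const M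
    rw [zero_mul] at hlim
    exact ((eventually_gt_atTop 0).and (hlim.eventually_lt_const hx)).exists
  have hDv : M - v x < (1 - Real.exp (-(c * t))) * M := by linarith
  set D := (1 - Real.exp (-(c * t))) * M
  have hD0 : 0 < D := (sub_nonneg.2 (hM x)).trans_lt hDv
  have hmass : ∀ W : Finset V, ∑ y ∈ W, dirichletHeatKernel G W t x y ≤ (M - v x) / D := by
    intro W
    by_cases hxW : x ∈ W
    · rw [le_div_iff₀' hD0]
      exact sum_dirichletHeatKernel_le G hc.le hM0.le hM hv ht.le hxW
    · rw [sum_eq_zero fun y _ => dirichletHeatKernel_of_notMem_left G t hxW y]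
      exact div_nonneg (sub_nonneg.2 (hM x)) hD0.le
  refine ⟨t, ht, x, ?_⟩
  calc ∑' y, heatKernel G t x y
      ≤ ENNReal.ofReal ((M - v x) / D) := by
        rw [tsum_heatKernel_eq_iSup G ht.le]
        exact iSup_le fun W => ENNReal.ofReal_le_ofReal (hmass W)
    _ < 1 := by rwa [ENNReal.ofReal_lt_one, div_lt_one hD0]

theorem not_stochasticallyIncomplete_of_le_laplacian (hc : 0 ≤ c) (hv0 : ∀ z, 0 ≤ v z)
    (hlim : Tendsto v cofinite atTop) (hv : ∀ z, -(c * v z) ≤ laplacian G v z) :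
    ¬StochasticallyIncomplete G := by
  rintro ⟨t, ht, x, hlt⟩
  have hone : Tendsto (fun C : ℝ => ENNReal.ofReal (1 - Real.exp (c * t) * v x / C)) atTop
      (𝓝 1) := by
    simpa using ENNReal.tendsto_ofReal
      ((tendsto_id.const_div_atTop (Real.exp (c * t) * v x)).const_sub 1)
  refine hlt.not_ge (le_of_tendsto hone ?_)
  filter_upwards [eventually_gt_atTop 0, eventually_gt_atTop (v x)] with C hC0 hCx
  have hfin : {z | ¬C ≤ v z}.Finite := eventually_cofinite.1 (hlim.eventually_ge_atTop C)
  rw [tsum_heatKernel_eq_iSup G ht.le]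
  refine le_iSup_of_le hfin.toFinset (ENNReal.ofReal_le_ofReal ?_)
  exact one_sub_le_sum_dirichletHeatKernel G hc hC0 hv0 (fun z hz => by simpa using hz)
    (fun z _ => hv z) ht.le (by simpa using hCx)

end HeatKernel

/-! ### Graphs with attached ends -/

section Ends

variable {V : Type*} (G : SimpleGraph V) [G.LocallyFinite] {n : V → ℕ} {u : V → ℝ}

theorem laplacian_attachEnds_inl (g : V ⊕ (Σ x : V, Fin (n x)) → ℝ) (x : V) :
    laplacian (attachEnds G n) g (Sum.inl x) =
      laplacian G (fun y => g (Sum.inl y)) x +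
        ∑ i : Fin (n x), (g (Sum.inl x) - g (Sum.inr ⟨x, i⟩)) := by
  have hnbhd : (attachEnds G n).neighborFinset (Sum.inl x) =
      (G.neighborFinset x).disjSum
        (univ.map (Function.Embedding.sigmaMk (β := fun x : V => Fin (n x)) x)) := by
    ext (y | ⟨z, i⟩)
    · rw [SimpleGraph.mem_neighborFinset, inl_mem_disjSum, SimpleGraph.mem_neighborFinset]
      rfl
    · simp only [SimpleGraph.mem_neighborFinset, inr_mem_disjSum, Finset.mem_map, mem_univ,
        true_and]
      constructor
      · rintro (rfl : z = x)
        exact ⟨i, rfl⟩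
      · rintro ⟨j, hj⟩
        exact (congrArg Sigma.fst hj).symm
  simp only [laplacian, hnbhd, sum_disjSum, sum_map, Function.Embedding.sigmaMk_apply]

theorem laplacian_attachEnds_inr (g : V ⊕ (Σ x : V, Fin (n x)) → ℝ) (e : Σ x : V, Fin (n x)) :
    laplacian (attachEnds G n) g (Sum.inr e) = g (Sum.inr e) - g (Sum.inl e.1) := by
  have hnbhd : (attachEnds G n).neighborFinset (Sum.inr e) = {Sum.inl e.1} := by
    ext (y | f)
    · rw [SimpleGraph.mem_neighborFinset, mem_singleton, Sum.inl.injEq, eq_comm (a := y)]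
      rfl
    · rw [SimpleGraph.mem_neighborFinset, mem_singleton]
      exact iff_of_false id Sum.inr_ne_inl
  rw [laplacian, hnbhd, sum_singleton]

/-- The extension of a function from the vertices of a graph to the ends attached to them by half
of its values. At the ends such an extension `v` satisfies `Δ v = -v`. -/
noncomputable def halveOnEnds (n : V → ℕ) (u : V → ℝ) : V ⊕ (Σ x : V, Fin (n x)) → ℝ :=
  Sum.elim u fun e => u e.1 / 2

theorem laplacian_halveOnEnds_inl (n : V → ℕ) (u : V → ℝ) (x : V) :
    laplacian (attachEnds G n) (halveOnEnds n u) (Sum.inl x) =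
      laplacian G u x + n x / 2 * u x := by
  rw [laplacian_attachEnds_inl]
  simp only [halveOnEnds, Sum.elim_inl, Sum.elim_inr, sub_half, sum_const, card_univ,
    Fintype.card_fin, nsmul_eq_mul]
  ring

theorem laplacian_halveOnEnds_inr (n : V → ℕ) (u : V → ℝ) (e : Σ x : V, Fin (n x)) :
    laplacian (attachEnds G n) (halveOnEnds n u) (Sum.inr e) = -halveOnEnds n u (Sum.inr e) := by
  rw [laplacian_attachEnds_inr]
  simp only [halveOnEnds, Sum.elim_inl, Sum.elim_inr]
  ring

theorem tendsto_halveOnEnds (n : V → ℕ) (hu0 : ∀ x, 0 ≤ u x) (hu : Tendsto u cofinite atTop) :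
    Tendsto (halveOnEnds n u) cofinite atTop := by
  set base : V ⊕ (Σ x : V, Fin (n x)) → V := Sum.elim id Sigma.fst
  have hbase : Tendsto base cofinite cofinite := by
    refine .cofinite_of_finite_preimage_singleton fun x => Set.Finite.subset
      ((Set.finite_singleton (Sum.inl x)).union
        (Set.finite_range fun i : Fin (n x) => Sum.inr ⟨x, i⟩)) ?_
    rintro (y | ⟨y, i⟩) (rfl : y = x)
    · exact Or.inl rfl
    · exact Or.inr ⟨i, rfl⟩
  refine tendsto_atTop_mono ?_ ((hu.comp hbase).atTop_div_const two_pos)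
  rintro (x | e)
  · exact half_le_self (hu0 x)
  · exact le_rfl

theorem stochasticallyIncomplete_attachEnds {M : ℝ} (hM : ∀ x, u x ≤ M)
    (hu : ∀ x, laplacian G u x ≤ -((1 + n x / 2) * u x)) {x : V} (hx : 0 < u x) :
    StochasticallyIncomplete (attachEnds G n) := by
  have hM0 : 0 < M := hx.trans_le (hM x)
  refine stochasticallyIncomplete_of_laplacian_le _ (v := halveOnEnds n u) (x := Sum.inl x)
    (M := M) one_pos ?_ ?_ hx
  · rintro (z | e)
    · exact hM z
    · change u e.1 / 2 ≤ M
      linarith [hM e.1]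
  · rintro (z | e)
    · rw [laplacian_halveOnEnds_inl, halveOnEnds, Sum.elim_inl]
      linarith [hu z]
    · rw [laplacian_halveOnEnds_inr, one_mul]

theorem not_stochasticallyIncomplete_attachEnds (hu0 : ∀ x, 0 ≤ u x)
    (hlim : Tendsto u cofinite atTop) (hu : ∀ x, -((1 + n x / 2) * u x) ≤ laplacian G u x) :
    ¬StochasticallyIncomplete (attachEnds G n) := by
  refine not_stochasticallyIncomplete_of_le_laplacian _ zero_le_one ?_
    (tendsto_halveOnEnds n hu0 hlim) ?_
  · rintro (z | e)
    · exact hu0 z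
    · exact div_nonneg (hu0 e.1) zero_le_two
  · rintro (z | e)
    · rw [laplacian_halveOnEnds_inl, halveOnEnds, Sum.elim_inl]
      linarith [hu z]
    · rw [laplacian_halveOnEnds_inr, one_mul]

end Ends

/-! ### Radial functions -/

section Radial

theorem monotone_prod_range_one_add {a : ℕ → ℝ} (ha : ∀ r, 0 ≤ a r) :
    Monotone fun r => ∏ i ∈ range r, (1 + a i) :=
  monotone_nat_of_le_succ fun r => by
    rw [prod_range_succ]
    exact le_mul_of_one_le_right (prod_nonneg fun i _ => add_nonneg zero_le_one (ha i))
      (le_add_of_nonneg_right (ha r))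

theorem one_add_sum_le_prod_one_add {ι : Type*} (s : Finset ι) {a : ι → ℝ} (ha : ∀ i, 0 ≤ a i) :
    1 + ∑ i ∈ s, a i ≤ ∏ i ∈ s, (1 + a i) := by
  classical
  induction s using Finset.induction_on with
  | empty => simp
  | insert j s hj ih =>
    rw [sum_insert hj, prod_insert hj]
    nlinarith [ha j, sum_nonneg fun i (_ : i ∈ s) => ha i]

theorem tendsto_prod_range_one_add {a : ℕ → ℝ} (ha : ∀ r, 0 ≤ a r) (hs : ¬Summable a) :
    Tendsto (fun r => ∏ i ∈ range r, (1 + a i)) atTop atTop :=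
  tendsto_atTop_mono
    (fun r => (le_add_of_nonneg_left zero_le_one).trans (one_add_sum_le_prod_one_add (range r) ha))
    ((not_summable_iff_tendsto_nat_atTop_of_nonneg ha).1 hs)

variable {V : Type*} {G : SimpleGraph V}

theorem finite_setOf_dist_lt [G.LocallyFinite] (hG : G.Connected) (x₀ : V) (R : ℕ) :
    {x | G.dist x₀ x < R}.Finite := by
  induction R with
  | zero => simp
  | succ R ih =>
    refine ((ih.biUnion fun x _ => (G.neighborSet x).toFinite).union
      (Set.finite_singleton x₀)).subset fun x (hx : G.dist x₀ x < R + 1) => ?_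
    obtain ⟨p, hp⟩ := hG.exists_walk_length_eq_dist x x₀
    cases p with
    | nil => exact Or.inr rfl
    | @cons _ y _ hxy p =>
      have hy : G.dist x₀ y ≤ p.length := G.dist_comm (u := x₀) ▸ G.dist_le p
      rw [SimpleGraph.Walk.length_cons, SimpleGraph.dist_comm] at hp
      exact Or.inl (Set.mem_biUnion (show G.dist x₀ y < R by lia) hxy.symm)

theorem tendsto_dist_cofinite [G.LocallyFinite] (hG : G.Connected) (x₀ : V) :
    Tendsto (G.dist x₀) cofinite atTop :=
  tendsto_atTop.2 fun R => eventually_cofinite.2 <| by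
    simpa only [not_le] using finite_setOf_dist_lt hG x₀ R

variable (G) [G.LocallyFinite] (x₀ : V)

/-- The outer degree `k₊` of a vertex `x` with respect to the root `x₀`: the number of neighbours
of `x` whose distance to `x₀` is larger by one than that of `x`. -/
noncomputable def outerDegree (x : V) : ℕ :=
  #{y ∈ G.neighborFinset x | G.dist x₀ y = G.dist x₀ x + 1}

/-- The inner degree `k₋` of a vertex `x` with respect to the root `x₀`: the number of neighbours
of `x` whose distance to `x₀` is smaller by one than that of `x`. -/
noncomputable def innerDegree (x : V) : ℕ :=
  #{y ∈ G.neighborFinset x | G.dist x₀ y + 1 = G.dist x₀ x}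

-- The truncated `G.dist x₀ x - 1` is harmless: the inner degree vanishes at distance zero.
theorem laplacian_comp_dist (f : ℕ → ℝ) (x : V) :
    laplacian G (f ∘ G.dist x₀) x =
      innerDegree G x₀ x * (f (G.dist x₀ x) - f (G.dist x₀ x - 1)) -
        outerDegree G x₀ x * (f (G.dist x₀ x + 1) - f (G.dist x₀ x)) := by
  set r := G.dist x₀ x with hr
  have hterm : ∀ y ∈ G.neighborFinset x, f r - f (G.dist x₀ y) =
      (if G.dist x₀ y + 1 = r then f r - f (r - 1) else 0) -
        if G.dist x₀ y = r + 1 then f (r + 1) - f r else 0 := by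
    intro y hy
    have hxy := ((G.mem_neighborFinset x y).1 hy).diff_dist_adj (u := x₀)
    rw [← hr] at hxy
    split_ifs with hin hout hout
    · lia
    · rw [← hin, add_tsub_cancel_right, sub_zero]
    · rw [hout]
      ring
    · rw [show G.dist x₀ y = r by lia, sub_self, sub_zero]
  simp only [laplacian, Function.comp_apply, ← hr]
  rw [sum_congr rfl hterm, sum_sub_distrib, ← sum_filter, ← sum_filter, sum_const, sum_const,
    nsmul_eq_mul, nsmul_eq_mul, innerDegree, outerDegree]

variable {G x₀} {n : V → ℕ} {a : ℕ → ℝ}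

theorem stochasticallyIncomplete_attachEnds_of_summable (ha : ∀ r, 0 ≤ a r) (hs : Summable a)
    (hdeg : ∀ x, innerDegree G x₀ x + 1 + (n x : ℝ) / 2 ≤ outerDegree G x₀ x * a (G.dist x₀ x)) :
    StochasticallyIncomplete (attachEnds G n) := by
  set f : ℕ → ℝ := fun r => ∏ i ∈ range r, (1 + a i)
  have hfpos : ∀ r, 0 < f r := fun r => prod_pos fun i _ => by linarith [ha i]
  have hfsucc : ∀ r, f (r + 1) - f r = a r * f r := fun r => by
    simp only [f, prod_range_succ]
    ring
  have hfM : ∀ r, f r ≤ Real.exp (∑' i, a i) := fun r =>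
    (Real.prod_one_add_le_exp_sum _ ha).trans
      (Real.exp_le_exp.2 (hs.sum_le_tsum _ fun i _ => ha i))
  refine stochasticallyIncomplete_attachEnds G (u := f ∘ G.dist x₀) (fun x => hfM _)
    (fun x => ?_) (x := x₀) (hfpos _)
  rw [laplacian_comp_dist, hfsucc, Function.comp_apply]
  set r := G.dist x₀ x
  have hin : (innerDegree G x₀ x : ℝ) * (f r - f (r - 1)) ≤ innerDegree G x₀ x * f r := by
    gcongr
    exact sub_le_self _ (hfpos _).le
  linarith [mul_le_mul_of_nonneg_right (hdeg x) (hfpos r).le]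

theorem not_stochasticallyIncomplete_attachEnds_of_not_summable (hG : G.Connected)
    (ha : ∀ r, 0 ≤ a r) (hs : ¬Summable a)
    (hdeg : ∀ x, outerDegree G x₀ x * a (G.dist x₀ x) ≤ 1 + (n x : ℝ) / 2) :
    ¬StochasticallyIncomplete (attachEnds G n) := by
  set f : ℕ → ℝ := fun r => ∏ i ∈ range r, (1 + a i)
  have hfnonneg : ∀ r, 0 ≤ f r := fun r => prod_nonneg fun i _ => by linarith [ha i]
  have hfsucc : ∀ r, f (r + 1) - f r = a r * f r := fun r => by
    simp only [f, prod_range_succ]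
    ring
  refine not_stochasticallyIncomplete_attachEnds G (u := f ∘ G.dist x₀) (fun x => hfnonneg _)
    ((tendsto_prod_range_one_add ha hs).comp (tendsto_dist_cofinite hG x₀)) fun x => ?_
  rw [laplacian_comp_dist, hfsucc, Function.comp_apply]
  set r := G.dist x₀ x
  have hin : 0 ≤ (innerDegree G x₀ x : ℝ) * (f r - f (r - 1)) :=
    mul_nonneg (Nat.cast_nonneg _)
      (sub_nonneg.2 (monotone_prod_range_one_add ha (Nat.sub_le r 1)))
  linarith [mul_le_mul_of_nonneg_right (hdeg x) (hfnonneg r)]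

theorem innerDegree_le_one_of_isTree (hG : G.IsTree) (x₀ x : V) : innerDegree G x₀ x ≤ 1 := by
  have hgeodesic : ∀ y ∈ {y ∈ G.neighborFinset x | G.dist x₀ y + 1 = G.dist x₀ x},
      ∃ p : G.Walk x₀ y, ∃ h : G.Adj y x, (p.concat h).IsPath := by
    intro y hy
    rw [mem_filter, SimpleGraph.mem_neighborFinset] at hy
    obtain ⟨p, hp⟩ := hG.connected.exists_walk_length_eq_dist x₀ y
    refine ⟨p, hy.1.symm, SimpleGraph.Walk.isPath_of_length_eq_dist _ ?_⟩
    rw [SimpleGraph.Walk.length_concat, hp, hy.2]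
  refine card_le_one.2 fun y hy z hz => ?_
  obtain ⟨p, _, hp⟩ := hgeodesic y hy
  obtain ⟨q, _, hq⟩ := hgeodesic z hz
  exact (SimpleGraph.Walk.concat_inj ((hG.existsUnique_path x₀ x).unique hp hq)).1

end Radial

end GraphHeat

theorem theorem4p2_general {V : Type*} (G : SimpleGraph V) [G.LocallyFinite] (x₀ : V)
    (k k' : ℕ → ℕ) (b : ℕ) (hk : ∀ r, 0 < k r) (hG : G.Connected)
    (houter : ∀ x, GraphHeat.outerDegree G x₀ x = k (G.dist x₀ x))
    (hinner : ∀ x, GraphHeat.innerDegree G x₀ x ≤ b) :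
    GraphHeat.StochasticallyIncomplete
        (GraphHeat.attachEnds G (fun x => k' (G.dist x₀ x))) ↔
      Summable (fun r : ℕ => ((k' r : ℝ) + 1) / (k r : ℝ)) := by
  have hk0 : ∀ r, (k r : ℝ) ≠ 0 := fun r => Nat.cast_ne_zero.2 (hk r).ne'
  refine ⟨fun hinc => ?_, fun hs => ?_⟩
  · by_contra hs
    refine GraphHeat.not_stochasticallyIncomplete_attachEnds_of_not_summable hG (x₀ := x₀)
      (a := fun r => 1 / 2 * ((k' r + 1) / k r)) (fun r => by positivity)
      (fun h => hs ((summable_mul_left_iff (by norm_num)).1 h)) (fun x => ?_) hinc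
    rw [houter, mul_left_comm, mul_div_cancel₀ _ (hk0 _)]
    linarith
  · refine GraphHeat.stochasticallyIncomplete_attachEnds_of_summable (x₀ := x₀)
      (a := fun r => (b + 1) * ((k' r + 1) / k r)) (fun r => by positivity)
      (hs.mul_left _) fun x => ?_
    have hb : (GraphHeat.innerDegree G x₀ x : ℝ) ≤ b := by exact_mod_cast hinner x
    rw [houter, mul_left_comm, mul_div_cancel₀ _ (hk0 _)]
    have hk' : (0 : ℝ) ≤ k' (G.dist x₀ x) := Nat.cast_nonneg _
    linarith [mul_nonneg (Nat.cast_nonneg (α := ℝ) b) hk']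

theorem theorem4p2 {V : Type*} (T : SimpleGraph V) [T.LocallyFinite] (x₀ : V)
    (k k' : ℕ → ℕ) (hk : ∀ r, 0 < k r)
    (hT : GraphHeat.IsSphericallySymmetricTree T x₀ k) :
    GraphHeat.StochasticallyIncomplete
        (GraphHeat.attachEnds T (fun x => k' (T.dist x₀ x))) ↔
      Summable (fun r : ℕ => ((k' r : ℝ) + 1) / (k r : ℝ)) := by
  exact theorem4p2_general T x₀ k k' 1 hk hT.isTree.connected hT.card_outer
    (GraphHeat.innerDegree_le_one_of_isTree hT.isTree x₀)
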